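/- A geometric graph consists of a finite set of points in the plane $\mathbb{R}^2$ (its vertices) and a set of straight segments joining pairs of distinct vertices (its edges), such that the interior of an edge contains no vertex; it is complete if every two distinct vertices are joined by an edge. Two subgraphs of a geometric graph cross if there are an edge of the first and an edge of the second that have exactly one interior point in common. A $K_t$-crossing family of a geometric graph is a collection of pairwise vertex-disjoint and pairwise crossing subgraphs, each isomorphic to the complete graph $K_t$. Let $S$ be a set of $n$ points in the plane in general position (no three collinear), and let $\mathsf{K}_n$ be the complete geometric graph with vertex set $S$. Then, for every integer $t \ge 4$, $\mathsf{K}_n$ contains a $K_t$-crossing family with exactly $\lfloor n/t \rfloor$ members. -/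

import Mathlib

/-- The Euclidean plane. -/
abbrev Plane : Type := EuclideanSpace ℝ (Fin 2)

/-- A set of points is in general position if no three distinct points of it are collinear. -/
def InGeneralPosition (S : Finset Plane) : Prop :=
  ∀ a ∈ S, ∀ b ∈ S, ∀ c ∈ S, a ≠ b → a ≠ c → b ≠ c → ¬ Collinear ℝ ({a, b, c} : Set Plane)

/-- A geometric graph: finitely many points of the plane together with a graph on them. The edge
`uv` is the straight segment from `u` to `v`; the interior of an edge contains no vertex. -/
structure GeometricGraph where
  verts : Finset Plane
  graph : SimpleGraph verts
  notMem_openSegment : ∀ u v w : verts, graph.Adj u v → (w : Plane) ∉ openSegment ℝ (u : Plane) v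

namespace GeometricGraph

/-- Every two distinct points are joined by an edge. -/
def IsComplete (G : GeometricGraph) : Prop :=
  ∀ u v : G.verts, u ≠ v → G.graph.Adj u v

/-- Two geometric subgraphs of `G` cross if some edge of the first and some edge of the second
have exactly one interior point in common. -/
def Cross {G : GeometricGraph} (A B : G.graph.Subgraph) : Prop :=
  ∃ a b c d : G.verts, A.Adj a b ∧ B.Adj c d ∧
    ∃! p : Plane, p ∈ openSegment ℝ (a : Plane) b ∩ openSegment ℝ (c : Plane) d

/-- A finite family of subgraphs of `G` is an `H`-crossing family if each member is isomorphic to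
`H` and any two different members are vertex-disjoint and cross. -/
structure IsCrossingFamily {G : GeometricGraph} {W : Type*} (H : SimpleGraph W)
    (F : Finset G.graph.Subgraph) : Prop where
  iso : ∀ A ∈ F, Nonempty (H ≃g A.coe)
  disjoint : ∀ A ∈ F, ∀ B ∈ F, A ≠ B → Disjoint A.verts B.verts
  cross : ∀ A ∈ F, ∀ B ∈ F, A ≠ B → Cross A B

end GeometricGraph

/-! Only four vertices per member matter: it suffices to find k = ⌊n/t⌋ disjoint quadruples that
pairwise span meeting segments, since the other t - 4 vertices of each member can be chosen
arbitrarily. Quarter 4k points by two lines, with k points in each closed quadrant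
(`exists_four_partition`). A quadruple with one point per quadrant has the intersection point of the
lines in its hull, so any two such hulls meet. The obstruction left is nesting. Among all ways to
form k disjoint transversals, one minimising a sum of exponential weights has no quadruple inside
the hull of another (`exists_transversals_not_nested`), because exchanging one point of a nested
pair lowers the sum. Hulls that meet without nesting have meeting segments (`exists_segments_meet`),
and general position makes these segments cross. -/

open Set

/-! ### Non-nested intersecting hulls -/

/-- If `p` lies in the convex hull of a plane set and `q` does not, then the segment `pq` meets a
segment spanned by two points of the set. -/
theorem exists_segment_inter_segment {A : Set Plane} {p q : Plane}
    (hp : p ∈ convexHull ℝ A) (hq : q ∉ convexHull ℝ A) :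
    ∃ a ∈ A, ∃ a' ∈ A, ∃ z ∈ segment ℝ p q, z ∈ segment ℝ a a' := by
  rw [convexHull_eq_union] at hp
  simp only [mem_iUnion] at hp
  obtain ⟨t, htA, hind, hpt⟩ := hp
  have hqt : q ∉ convexHull ℝ (t : Set Plane) := fun h => hq (convexHull_mono htA h)
  have hcard : t.card ≤ 3 := by
    have h := hind.card_le_finrank_succ
    have h2 := Submodule.finrank_le (vectorSpan ℝ (Set.range ((↑) : t → Plane)))
    simp only [Fintype.card_coe, finrank_euclideanSpace, Fintype.card_fin] at h h2
    omega
  obtain h0 | h1 | h2 | h3 : t.card = 0 ∨ t.card = 1 ∨ t.card = 2 ∨ t.card = 3 := by omega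
  · simp [Finset.card_eq_zero.1 h0] at hpt
  · obtain ⟨a, rfl⟩ := Finset.card_eq_one.1 h1
    have ha : a ∈ A := htA (by simp)
    refine ⟨a, ha, a, ha, p, left_mem_segment _ _ _, ?_⟩
    simpa using hpt
  · obtain ⟨a, b, -, rfl⟩ := Finset.card_eq_two.1 h2
    refine ⟨a, htA (by simp), b, htA (by simp), p, left_mem_segment _ _ _, ?_⟩
    simpa [convexHull_pair] using hpt
  · have htop : affineSpan ℝ (Set.range ((↑) : t → Plane)) = ⊤ := by
      rw [hind.affineSpan_eq_top_iff_card_eq_finrank_add_one]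
      simp [h3]
    let e : t ≃ Fin 3 := t.equivFinOfCardEq h3
    let b : AffineBasis (Fin 3) ℝ Plane := (AffineBasis.mk _ hind htop).reindex e
    have hb : ∀ i, b i ∈ A := fun i => htA (e.symm i).2
    have hrange : Set.range b = (t : Set Plane) := by
      ext x
      constructor
      · rintro ⟨i, rfl⟩
        exact (e.symm i).2
      · intro hx
        exact ⟨e ⟨x, hx⟩, congrArg Subtype.val (e.symm_apply_apply ⟨x, hx⟩)⟩
    rw [← hrange, b.convexHull_eq_nonneg_coord] at hpt hqt
    simp only [mem_ofPred_eq, not_forall, not_le] at hpt hqt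
    obtain ⟨j, hj⟩ := hqt
    let c : Fin 3 → ℝ → ℝ := fun i s => b.coord i (AffineMap.lineMap p q s)
    have hc : ∀ i s, c i s = (1 - s) * b.coord i p + s * b.coord i q := by
      intro i s
      simp only [c, AffineMap.apply_lineMap, AffineMap.lineMap_apply_ring]
    have hcont : ∀ i, Continuous (c i) := by
      intro i
      have : c i = fun s => (1 - s) * b.coord i p + s * b.coord i q := funext (hc i)
      rw [this]
      fun_prop
    -- The least barycentric coordinate is nonnegative at `p` and negative at `q`. Where it
    -- vanishes, the point lies on a side of the triangle.
    have hivt : (0 : ℝ) ∈ (fun s => min (c 0 s) (min (c 1 s) (c 2 s))) '' Icc 0 1 := by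
      apply intermediate_value_Icc' zero_le_one
      · exact ((hcont 0).min ((hcont 1).min (hcont 2))).continuousOn
      · constructor
        · simp only [hc]
          have : min (b.coord 0 q) (min (b.coord 1 q) (b.coord 2 q)) ≤ b.coord j q := by
            fin_cases j <;> simp
          simpa using this.trans hj.le
        · simp [hc, hpt]
    obtain ⟨s, hs, hmin⟩ := hivt
    simp only at hmin
    have hz : AffineMap.lineMap p q s ∈ segment ℝ p q := by
      rw [segment_eq_image_lineMap]
      exact ⟨s, hs, rfl⟩
    have hsum : c 0 s + c 1 s + c 2 s = 1 := by
      have := b.sum_coord_apply_eq_one (AffineMap.lineMap p q s)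
      rwa [Fin.sum_univ_three] at this
    have hcomb : c 0 s • b 0 + c 1 s • b 1 + c 2 s • b 2 = AffineMap.lineMap p q s := by
      have := b.linear_combination_coord_eq_self (AffineMap.lineMap p q s)
      rwa [Fin.sum_univ_three] at this
    have h0 : 0 ≤ c 0 s := hmin ▸ min_le_left _ _
    have h1 : 0 ≤ c 1 s := hmin ▸ (min_le_right _ _).trans (min_le_left _ _)
    have h2 : 0 ≤ c 2 s := hmin ▸ (min_le_right _ _).trans (min_le_right _ _)
    have hzero : c 0 s = 0 ∨ c 1 s = 0 ∨ c 2 s = 0 := by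
      rcases min_choice (c 0 s) (min (c 1 s) (c 2 s)) with h | h
      · exact Or.inl (h ▸ hmin)
      · rcases min_choice (c 1 s) (c 2 s) with h' | h'
        · exact Or.inr (Or.inl (by rw [← h', ← h, hmin]))
        · exact Or.inr (Or.inr (by rw [← h', ← h, hmin]))
    rcases hzero with h | h | h
    · exact ⟨b 1, hb 1, b 2, hb 2, _, hz, c 1 s, c 2 s, h1, h2, by linarith, by
        rw [← hcomb, h]; simp⟩
    · exact ⟨b 0, hb 0, b 2, hb 2, _, hz, c 0 s, c 2 s, h0, h2, by linarith, by
        rw [← hcomb, h]; simp⟩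
    · exact ⟨b 0, hb 0, b 1, hb 1, _, hz, c 0 s, c 1 s, h0, h1, by linarith, by
        rw [← hcomb, h]; simp⟩

/-- Two plane sets whose convex hulls meet, neither contained in the convex hull of the other, span
two segments that meet. -/
theorem exists_segments_meet {A B : Set Plane} {z a₀ b₀ : Plane}
    (hzA : z ∈ convexHull ℝ A) (hzB : z ∈ convexHull ℝ B)
    (ha₀ : a₀ ∈ A) (ha₀B : a₀ ∉ convexHull ℝ B) (hb₀ : b₀ ∈ B) (hb₀A : b₀ ∉ convexHull ℝ A) :
    ∃ a ∈ A, ∃ a' ∈ A, ∃ b ∈ B, ∃ b' ∈ B, (segment ℝ a a' ∩ segment ℝ b b').Nonempty := by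
  obtain ⟨a, ha, a', ha', w, hw, hwa⟩ := exists_segment_inter_segment hzA hb₀A
  have hwB : w ∈ convexHull ℝ B :=
    (convex_convexHull ℝ B).segment_subset hzB (subset_convexHull ℝ B hb₀) hw
  -- Some segment spanned by `A` must leave the hull of `B`: either `a a₀`, or the part of `a a'`
  -- from `w` to `a`.
  by_cases haB : a ∈ convexHull ℝ B
  · obtain ⟨b, hb, b', hb', v, hv, hvb⟩ := exists_segment_inter_segment haB ha₀B
    exact ⟨a, ha, a₀, ha₀, b, hb, b', hb', v, hv, hvb⟩
  · obtain ⟨b, hb, b', hb', v, hv, hvb⟩ := exists_segment_inter_segment hwB haB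
    refine ⟨a, ha, a', ha', b, hb, b', hb', v, ?_, hvb⟩
    exact (convex_segment a a').segment_subset hwa (left_mem_segment _ _ _) hv

/-! ### Proper crossings in general position -/

theorem InGeneralPosition.notMem_segment {S : Finset Plane} (hS : InGeneralPosition S)
    {a b c : Plane} (ha : a ∈ S) (hb : b ∈ S) (hc : c ∈ S) (hab : a ≠ b) (hac : a ≠ c) :
    a ∉ segment ℝ b c := by
  intro h
  by_cases hbc : b = c
  · subst hbc
    exact hab (by simpa using h)
  · have hw : Wbtw ℝ b a c := mem_segment_iff_wbtw.1 h
    refine hS b hb a ha c hc hab.symm hbc hac hw.collinear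

/-- In general position, segments with four different end points that meet have exactly one
interior point in common. -/
theorem InGeneralPosition.existsUnique_mem_openSegments {S : Finset Plane}
    (hS : InGeneralPosition S) {a a' b b' : Plane} (ha : a ∈ S) (ha' : a' ∈ S) (hb : b ∈ S)
    (hb' : b' ∈ S) (hab : a ≠ b) (hab' : a ≠ b') (ha'b : a' ≠ b) (ha'b' : a' ≠ b')
    (h : (segment ℝ a a' ∩ segment ℝ b b').Nonempty) :
    a ≠ a' ∧ b ≠ b' ∧ ∃! p : Plane, p ∈ openSegment ℝ a a' ∩ openSegment ℝ b b' := by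
  obtain ⟨z, hza, hzb⟩ := h
  have hza1 : a ≠ z := by rintro rfl; exact hS.notMem_segment ha hb hb' hab hab' hzb
  have hza2 : a' ≠ z := by rintro rfl; exact hS.notMem_segment ha' hb hb' ha'b ha'b' hzb
  have hzb1 : b ≠ z := by rintro rfl; exact hS.notMem_segment hb ha ha' hab.symm ha'b.symm hza
  have hzb2 : b' ≠ z := by
    rintro rfl; exact hS.notMem_segment hb' ha ha' hab'.symm ha'b'.symm hza
  have haa : a ≠ a' := by
    rintro rfl; exact hza1 (by simpa [eq_comm] using hza)
  have hbb : b ≠ b' := by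
    rintro rfl; exact hzb1 (by simpa [eq_comm] using hzb)
  refine ⟨haa, hbb, z, ⟨mem_openSegment_of_ne_left_right hza1 hza2 hza,
    mem_openSegment_of_ne_left_right hzb1 hzb2 hzb⟩, ?_⟩
  rintro y ⟨hya, hyb⟩
  -- Two common points would make the two lines equal, putting `b` on the line `a a'`.
  by_contra hne
  have hline : ∀ {u v w : Plane}, w ∈ segment ℝ u v → w ∈ line[ℝ, u, v] := fun {u v w} hw =>
    (mem_segment_iff_wbtw.1 hw).mem_affineSpan
  have key : ∀ {u v : Plane}, y ∈ segment ℝ u v → z ∈ segment ℝ u v →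
      line[ℝ, y, z] = line[ℝ, u, v] := by
    intro u v hy hz
    exact affineSpan_pair_eq_of_mem_of_mem_of_ne (hline hy) (hline hz) hne
  have hsame := (key (openSegment_subset_segment _ _ _ hya) hza).symm.trans
    (key (openSegment_subset_segment _ _ _ hyb) hzb)
  have hbl : b ∈ line[ℝ, a, a'] := hsame ▸ left_mem_affineSpan_pair ℝ b b'
  have := collinear_insert_of_mem_affineSpan_pair hbl
  exact hS b hb a ha a' ha' hab.symm ha'b.symm haa this

/-! ### Order statistics and quartering by two lines -/

/-- The `k`-th smallest of finitely many continuous functions is continuous. -/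
theorem exists_continuous_orderStatistic {α : Type*} (L : Finset α) {k : ℕ} (hk : 0 < k)
    (hkL : k ≤ L.card) {v : α → ℝ → ℝ} (hv : ∀ p, Continuous (v p)) :
    ∃ μ : ℝ → ℝ, Continuous μ ∧ ∀ m,
      (L.filter fun p => v p m < μ m).card < k ∧ k ≤ (L.filter fun p => v p m ≤ μ m).card := by
  have hne : (L.powersetCard k).attach.Nonempty := by
    rw [Finset.attach_nonempty_iff]
    exact Finset.powersetCard_nonempty.2 hkL
  have hT : ∀ T : L.powersetCard k, T.1.Nonempty := by
    intro T
    rw [← Finset.card_pos, (Finset.mem_powersetCard.1 T.2).2]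
    exact hk
  -- The `k`-th smallest value is the minimum, over `k`-subsets, of the maximum on the subset.
  refine ⟨fun m => (L.powersetCard k).attach.inf' hne fun T => T.1.sup' (hT T) fun p => v p m,
    ?_, fun m => ⟨?_, ?_⟩⟩
  · exact Continuous.finset_inf'_apply hne fun T _ =>
      Continuous.finset_sup'_apply (hT T) fun p _ => hv p
  · by_contra! hcon
    obtain ⟨T, hTs, hTc⟩ := Finset.exists_subset_card_eq hcon
    have hTm : T ∈ L.powersetCard k :=
      Finset.mem_powersetCard.2 ⟨hTs.trans (Finset.filter_subset _ _), hTc⟩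
    have h1 := Finset.inf'_le (fun T : L.powersetCard k => T.1.sup' (hT T) fun p => v p m)
      (Finset.mem_attach _ ⟨T, hTm⟩)
    obtain ⟨p, hp, hpe⟩ := Finset.exists_mem_eq_sup' (hT ⟨T, hTm⟩) fun p => v p m
    have h2 := (Finset.mem_filter.1 (hTs hp)).2
    exact absurd (hpe ▸ h1) (not_le.2 h2)
  · obtain ⟨T, -, hTe⟩ := Finset.exists_mem_eq_inf' hne
      fun T : L.powersetCard k => T.1.sup' (hT T) fun p => v p m
    obtain ⟨hTL, hTc⟩ := Finset.mem_powersetCard.1 T.2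
    simp only [hTe]
    nth_rw 1 [← hTc]
    exact Finset.card_le_card fun p hp => Finset.mem_filter.2
      ⟨hTL hp, Finset.le_sup' (fun p => v p m) hp⟩

/-- Ties at `μ` may be split arbitrarily, which allows exact cardinalities even when points lie on
the cutting line. -/
theorem exists_subset_card_eq_of_orderStatistic {α : Type*} [DecidableEq α] {L : Finset α} {k : ℕ}
    {u : α → ℝ} {μ : ℝ} (h₁ : (L.filter fun p => u p < μ).card < k)
    (h₂ : k ≤ (L.filter fun p => u p ≤ μ).card) :
    ∃ T ⊆ L, T.card = k ∧ (∀ p ∈ T, u p ≤ μ) ∧ ∀ p ∈ L \ T, μ ≤ u p := by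
  obtain ⟨T, hT1, hT2, hTc⟩ := Finset.exists_subsuperset_card_eq
    (Finset.monotone_filter_right L fun p _ (h : u p < μ) => h.le) h₁.le h₂
  refine ⟨T, hT2.trans (Finset.filter_subset _ _), hTc,
    fun p hp => (Finset.mem_filter.1 (hT2 hp)).2, fun p hp => ?_⟩
  rw [Finset.mem_sdiff] at hp
  by_contra! hlt
  exact hp.2 (hT1 (Finset.mem_filter.2 ⟨hp.1, hlt⟩))

theorem orderStatistic_le_orderStatistic {α : Type*} {L R : Finset α} {k : ℕ} (hk : 0 < k)
    (hkR : k ≤ R.card) {u : α → ℝ} {μ ν : ℝ} (hL : k ≤ (L.filter fun p => u p ≤ μ).card)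
    (hR : (R.filter fun p => u p < ν).card < k) (h : ∀ l ∈ L, ∀ r ∈ R, u r ≤ u l) : ν ≤ μ := by
  obtain ⟨l, hl⟩ := Finset.card_pos.1 (hk.trans_le hL)
  rw [Finset.mem_filter] at hl
  obtain ⟨r, hr, hrν⟩ : ∃ r ∈ R, ν ≤ u r := by
    by_contra! hcon
    rw [Finset.filter_true_of_mem hcon] at hR
    omega
  exact hrν.trans ((h l hl.1 r hr).trans hl.2)

/-- Ham-sandwich cut of two sets separated by the coordinate `X`: some line `Y - m X = d` has `k`
points of each of them on either side. -/
theorem exists_line_bisecting {α : Type*} {L R : Finset α} {k : ℕ} (hk : 0 < k)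
    (hL : k ≤ L.card) (hR : k ≤ R.card) {X Y : α → ℝ} (hX : ∀ l ∈ L, ∀ r ∈ R, X l < X r) :
    ∃ m d : ℝ,
      ((L.filter fun p => Y p - m * X p < d).card < k ∧
        k ≤ (L.filter fun p => Y p - m * X p ≤ d).card) ∧
      ((R.filter fun p => Y p - m * X p < d).card < k ∧
        k ≤ (R.filter fun p => Y p - m * X p ≤ d).card) := by
  have hv : ∀ p, Continuous fun m : ℝ => Y p - m * X p := fun p => by fun_prop
  obtain ⟨μ, hμ, hμL⟩ := exists_continuous_orderStatistic L hk hL hv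
  obtain ⟨ν, hν, hνR⟩ := exists_continuous_orderStatistic R hk hR hv
  have htop : ∀ᶠ m : ℝ in Filter.atTop, ν m ≤ μ m := by
    have : ∀ᶠ m : ℝ in Filter.atTop, ∀ l ∈ L, ∀ r ∈ R, Y r - m * X r ≤ Y l - m * X l := by
      rw [Filter.eventually_all_finset]
      intro l hl
      rw [Filter.eventually_all_finset]
      intro r hr
      -- The threshold is the slope of the line through `l` and `r`; the order of the two values
      -- flips there.
      filter_upwards [Filter.eventually_ge_atTop ((Y r - Y l) / (X r - X l))] with m hm
      rw [div_le_iff₀ (sub_pos.2 (hX l hl r hr))] at hm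
      linarith
    filter_upwards [this] with m hm
    exact orderStatistic_le_orderStatistic hk hR (hμL m).2 (hνR m).1 hm
  have hbot : ∀ᶠ m : ℝ in Filter.atBot, μ m ≤ ν m := by
    have : ∀ᶠ m : ℝ in Filter.atBot, ∀ r ∈ R, ∀ l ∈ L, Y l - m * X l ≤ Y r - m * X r := by
      rw [Filter.eventually_all_finset]
      intro r hr
      rw [Filter.eventually_all_finset]
      intro l hl
      filter_upwards [Filter.eventually_le_atBot ((Y r - Y l) / (X r - X l))] with m hm
      rw [le_div_iff₀ (sub_pos.2 (hX l hl r hr))] at hm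
      linarith
    filter_upwards [this] with m hm
    exact orderStatistic_le_orderStatistic hk hL (hνR m).2 (hμL m).1 hm
  obtain ⟨m₁, h₁⟩ := htop.exists
  obtain ⟨m₂, h₂⟩ := hbot.exists
  obtain ⟨m, hm⟩ := mem_range_of_exists_le_of_exists_ge (hμ.sub hν)
    ⟨m₂, sub_nonpos.2 h₂⟩ ⟨m₁, sub_nonneg.2 h₁⟩
  refine ⟨m, μ m, hμL m, ?_⟩
  rw [sub_eq_zero.1 hm]
  exact hνR m

/-- Two lines cut `4 k` points into four sets of `k` points, one in each closed quadrant. -/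
theorem exists_four_partition {α : Type*} [DecidableEq α] {S : Finset α} {k : ℕ} (hk : 0 < k)
    (hS : S.card = 4 * k) {X Y : α → ℝ} (hX : Set.InjOn X S) :
    ∃ (c m d : ℝ) (Q : Fin 4 → Finset α), (∀ j, Q j ⊆ S) ∧ (∀ j, (Q j).card = k) ∧
      (∀ i j, i ≠ j → Disjoint (Q i) (Q j)) ∧
      (∀ p ∈ Q 0, X p ≤ c ∧ Y p - m * X p ≤ d) ∧ (∀ p ∈ Q 1, X p ≤ c ∧ d ≤ Y p - m * X p) ∧
      (∀ p ∈ Q 2, c ≤ X p ∧ Y p - m * X p ≤ d) ∧ (∀ p ∈ Q 3, c ≤ X p ∧ d ≤ Y p - m * X p) := by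
  obtain ⟨μ, -, hμ⟩ := exists_continuous_orderStatistic S (k := 2 * k) (by omega) (by omega)
    (v := fun p _ => X p) fun p => continuous_const
  obtain ⟨L, hLS, hLc, hLX, hRX⟩ := exists_subset_card_eq_of_orderStatistic (hμ 0).1 (hμ 0).2
  have hRc : (S \ L).card = 2 * k := by
    rw [Finset.card_sdiff_of_subset hLS]
    omega
  have hlt : ∀ l ∈ L, ∀ r ∈ S \ L, X l < X r := by
    intro l hl r hr
    refine ((hLX l hl).trans (hRX r hr)).lt_of_ne fun h => ?_
    have hr' := Finset.mem_sdiff.1 hr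
    exact hr'.2 (hX (hLS hl) hr'.1 h ▸ hl)
  obtain ⟨m, d, hL, hR⟩ := exists_line_bisecting (Y := Y) hk (by omega) (by omega) hlt
  obtain ⟨A, hAL, hAc, hA1, hA2⟩ := exists_subset_card_eq_of_orderStatistic hL.1 hL.2
  obtain ⟨B, hBR, hBc, hB1, hB2⟩ := exists_subset_card_eq_of_orderStatistic hR.1 hR.2
  have hLR : Disjoint L (S \ L) := Finset.disjoint_sdiff
  have hAA : Disjoint A (L \ A) := Finset.disjoint_sdiff
  have hBB : Disjoint B ((S \ L) \ B) := Finset.disjoint_sdiff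
  have hcross : ∀ {U V : Finset α}, U ⊆ L → V ⊆ S \ L → Disjoint U V := fun hU hV =>
    Finset.disjoint_of_subset_left hU (Finset.disjoint_of_subset_right hV hLR)
  have hA' : L \ A ⊆ L := Finset.sdiff_subset
  have hB' : (S \ L) \ B ⊆ S \ L := Finset.sdiff_subset
  have hRS : S \ L ⊆ S := Finset.sdiff_subset
  refine ⟨μ 0, m, d, ![A, L \ A, B, (S \ L) \ B], ?_, ?_, ?_, ?_, ?_, ?_, ?_⟩
  · simp only [Fin.forall_fin_succ]
    exact ⟨hAL.trans hLS, hA'.trans hLS, hBR.trans hRS, hB'.trans hRS, fun i => i.elim0⟩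
  · have h1 : (L \ A).card = k := by rw [Finset.card_sdiff_of_subset hAL]; omega
    have h2 : ((S \ L) \ B).card = k := by rw [Finset.card_sdiff_of_subset hBR]; omega
    simp only [Fin.forall_fin_succ]
    exact ⟨hAc, h1, hBc, h2, fun i => i.elim0⟩
  · have hsym : ∀ i j : Fin 4, i < j → Disjoint (![A, L \ A, B, (S \ L) \ B] i)
        (![A, L \ A, B, (S \ L) \ B] j) := by
      intro i j hij
      fin_cases i <;> fin_cases j <;> first
        | exact absurd hij (by decide)
        | exact hAA
        | exact hBB
        | exact hcross hAL hBR
        | exact hcross hAL hB'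
        | exact hcross hA' hBR
        | exact hcross hA' hB'
    intro i j hij
    rcases lt_or_gt_of_ne hij with h | h
    · exact hsym i j h
    · exact (hsym j i h).symm
  · exact fun p hp => ⟨hLX p (hAL hp), hA1 p hp⟩
  · exact fun p hp => ⟨hLX p (hA' hp), hA2 p hp⟩
  · exact fun p hp => ⟨hRX p (hBR hp), hB1 p hp⟩
  · exact fun p hp => ⟨hRX p (hB' hp), hB2 p hp⟩

/-! ### Transversals with non-nested hulls -/

/-- The convex hull of a finite set with at least two points has at least two extreme points. -/
theorem nontrivial_extremePoints_convexHull {A : Set Plane} (hA : A.Finite)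
    (hA' : A.Nontrivial) : ((convexHull ℝ A).extremePoints ℝ).Nontrivial := by
  by_contra h
  rw [Set.not_nontrivial_iff] at h
  have hkm := closure_convexHull_extremePoints (hA.isCompact_convexHull ℝ) (convex_convexHull ℝ A)
  have hsub : (convexHull ℝ A).Subsingleton := by
    rw [← hkm]
    rcases h.eq_empty_or_singleton with h | ⟨x, h⟩ <;> simp [h]
  exact Set.not_subsingleton_iff.2 hA' (hsub.anti (subset_convexHull ℝ A))

/-- If a subset of `convexHull ℝ A` avoids an extreme point, then so does its convex hull. -/
theorem notMem_convexHull_of_mem_extremePoints {A B : Set Plane} {x : Plane}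
    (hx : x ∈ (convexHull ℝ A).extremePoints ℝ) (hB : B ⊆ convexHull ℝ A) (hxB : x ∉ B) :
    x ∉ convexHull ℝ B := by
  rw [(convex_convexHull ℝ A).mem_extremePoints_iff_convex_sdiff] at hx
  intro h
  exact (convexHull_min (subset_sdiff.2 ⟨hB, disjoint_singleton_right.2 hxB⟩) hx.2 h).2 rfl

open Classical in
/-- The number of points of `S` in the convex hull of `A`. -/
noncomputable def hullCount (S : Finset Plane) (A : Set Plane) : ℕ :=
  (S.filter fun p => p ∈ convexHull ℝ A).card

theorem hullCount_lt {S : Finset Plane} {A B : Set Plane} {x : Plane} (hxS : x ∈ S)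
    (hx : x ∈ (convexHull ℝ A).extremePoints ℝ) (hB : B ⊆ convexHull ℝ A) (hxB : x ∉ B) :
    hullCount S B < hullCount S A := by
  classical
  apply Finset.card_lt_card
  rw [Finset.ssubset_iff_of_subset]
  · refine ⟨x, Finset.mem_filter.2 ⟨hxS, hx.1⟩, fun h => ?_⟩
    exact notMem_convexHull_of_mem_extremePoints hx hB hxB (Finset.mem_filter.1 h).2
  · exact Finset.monotone_filter_right S fun p _ hp =>
      convexHull_min hB (convex_convexHull ℝ A) hp

/-- Disjoint sets of equal size can be cut into transversals none of which lies in the convex hull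
of another one: minimise the sum of `3 ^ hullCount`. -/
theorem exists_transversals_not_nested {ι : Type*} [Fintype ι] [DecidableEq ι] [Nontrivial ι]
    {k : ℕ} (Q : ι → Finset Plane) (hcard : ∀ j, (Q j).card = k)
    (hdisj : ∀ i j, i ≠ j → Disjoint (Q i) (Q j)) :
    ∃ f : Fin k → ι → Plane, (∀ a j, f a j ∈ Q j) ∧ (∀ a b i j, f a i = f b j → a = b ∧ i = j) ∧
      ∀ a b, a ≠ b → ∃ j, f b j ∉ convexHull ℝ (Set.range (f a)) := by
  classical
  let S : Finset Plane := Finset.univ.biUnion Q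
  let V : Set (Fin k → ι → Plane) :=
    {f | (∀ a j, f a j ∈ Q j) ∧ ∀ j, Function.Injective fun a => f a j}
  let φ : (Fin k → ι → Plane) → ℕ := fun f => ∑ a, 3 ^ hullCount S (Set.range (f a))
  have hV : V.Nonempty := by
    refine ⟨fun a j => ((Q j).equivFinOfCardEq (hcard j)).symm a, fun a j => Subtype.coe_prop _,
      fun j => ?_⟩
    exact Subtype.val_injective.comp (Equiv.injective _)
  obtain ⟨f, ⟨hfQ, hfinj⟩, hmin⟩ : ∃ f ∈ V, ∀ g ∈ V, φ f ≤ φ g :=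
    ⟨Function.argminOn φ V hV, Function.argminOn_mem φ V hV,
      fun g hg => Function.argminOn_le φ V hg⟩
  have hinj : ∀ a b i j, f a i = f b j → a = b ∧ i = j := by
    intro a b i j h
    have hij : i = j := by
      by_contra hne
      exact Finset.disjoint_left.1 (hdisj i j hne) (hfQ a i) (h ▸ hfQ b j)
    subst hij
    exact ⟨hfinj i h, rfl⟩
  refine ⟨f, hfQ, hinj, fun a b hab => ?_⟩
  by_contra! hnest
  have hnt : (Set.range (f a)).Nontrivial := by
    obtain ⟨i, j, hij⟩ := exists_pair_ne ι
    exact ⟨f a i, ⟨i, rfl⟩, f a j, ⟨j, rfl⟩, fun h => hij (hinj _ _ _ _ h).2⟩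
  obtain ⟨x, hx, y, hy, hxy⟩ :=
    nontrivial_extremePoints_convexHull (Set.finite_range (f a)) hnt
  obtain ⟨i, rfl⟩ := extremePoints_convexHull_subset hx
  obtain ⟨j, rfl⟩ := extremePoints_convexHull_subset hy
  -- Exchange the `i`-th points of `a` and `b`. Both new transversals stay in the old hull of `a`;
  -- the new `a` loses the extreme point `f a i`, the new `b` lacks the extreme point `f a j`.
  let g : Fin k → ι → Plane := fun c l => f (if l = i then Equiv.swap a b c else c) l
  have hgV : g ∈ V := by
    refine ⟨fun c l => hfQ _ l, fun l => ?_⟩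
    by_cases hl : l = i
    · subst hl
      simp only [g, if_true]
      exact (hfinj l).comp (Equiv.swap a b).injective
    · simpa [g, hl] using hfinj l
  have hS : ∀ c l, f c l ∈ S := fun c l => Finset.mem_biUnion.2 ⟨l, Finset.mem_univ _, hfQ c l⟩
  have hga : hullCount S (Set.range (g a)) < hullCount S (Set.range (f a)) := by
    refine hullCount_lt (hS a i) hx ?_ ?_
    · rintro _ ⟨l, rfl⟩
      by_cases hl : l = i
      · simpa [g, hl] using hnest i
      · simpa [g, hl] using subset_convexHull ℝ _ (Set.mem_range_self l)
    · rintro ⟨l, hl⟩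
      have h := hinj _ _ _ _ hl
      rw [if_pos h.2, Equiv.swap_apply_left] at h
      exact hab h.1.symm
  have hgb : hullCount S (Set.range (g b)) < hullCount S (Set.range (f a)) := by
    refine hullCount_lt (hS a j) hy ?_ ?_
    · rintro _ ⟨l, rfl⟩
      by_cases hl : l = i
      · simpa [g, hl] using subset_convexHull ℝ _ (Set.mem_range_self i)
      · simpa [g, hl] using hnest l
    · rintro ⟨l, hl⟩
      have h := hinj _ _ _ _ hl
      have hli : l ≠ i := by
        rintro rfl
        exact hxy (by rw [h.2])
      rw [if_neg hli] at h
      exact hab h.1.symm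
  have hgc : ∀ c, c ≠ a → c ≠ b → g c = f c := by
    intro c hca hcb
    funext l
    simp [g, Equiv.swap_apply_of_ne_of_ne hca hcb]
  refine absurd (hmin g hgV) (not_le.2 ?_)
  have hb : b ∈ Finset.univ.erase a := Finset.mem_erase.2 ⟨hab.symm, Finset.mem_univ b⟩
  simp only [φ]
  rw [← Finset.add_sum_erase _ _ (Finset.mem_univ a), ← Finset.add_sum_erase _ _ hb,
    ← Finset.add_sum_erase Finset.univ (fun a => 3 ^ hullCount S (Set.range (f a)))
      (Finset.mem_univ a), ← Finset.add_sum_erase (Finset.univ.erase a)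
      (fun a => 3 ^ hullCount S (Set.range (f a))) hb]
  have hrest : ∑ c ∈ (Finset.univ.erase a).erase b, 3 ^ hullCount S (Set.range (g c)) =
      ∑ c ∈ (Finset.univ.erase a).erase b, 3 ^ hullCount S (Set.range (f c)) := by
    refine Finset.sum_congr rfl fun c hc => ?_
    rw [Finset.mem_erase, Finset.mem_erase] at hc
    rw [hgc c hc.2.1 hc.1]
  rw [hrest]
  -- Each new weight is at most a third of the old weight of `a`, so together they are below it,
  -- whatever `b` weighed.
  have h3 : ∀ {u v : ℕ}, u < v → 3 * 3 ^ u ≤ 3 ^ v := fun {u v} h => by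
    rw [← pow_succ']
    exact Nat.pow_le_pow_right (by norm_num) h
  have h4 := h3 hga
  have h5 := h3 hgb
  have h6 : 0 < 3 ^ hullCount S (Set.range (f a)) := by positivity
  have h7 : 0 < 3 ^ hullCount S (Set.range (f b)) := by positivity
  omega

/-! ### Quadruples around the intersection of two lines -/

theorem exists_mem_segment_apply_eq (f : Plane →ₗ[ℝ] ℝ) {p q : Plane} {c : ℝ} (hp : f p ≤ c)
    (hq : c ≤ f q) : ∃ z ∈ segment ℝ p q, f z = c := by
  have h : c ∈ f '' segment ℝ p q := by
    rw [← LinearMap.coe_toAffineMap, image_segment, LinearMap.coe_toAffineMap,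
      segment_eq_Icc (hp.trans hq)]
    exact ⟨hp, hq⟩
  exact h

theorem le_apply_of_mem_segment (f : Plane →ₗ[ℝ] ℝ) {p q z : Plane} {d : ℝ} (hp : d ≤ f p)
    (hq : d ≤ f q) (hz : z ∈ segment ℝ p q) : d ≤ f z :=
  (convex_halfSpace_ge f.isLinear d).segment_subset hp hq hz

theorem apply_le_of_mem_segment (f : Plane →ₗ[ℝ] ℝ) {p q z : Plane} {d : ℝ} (hp : f p ≤ d)
    (hq : f q ≤ d) (hz : z ∈ segment ℝ p q) : f z ≤ d :=
  (convex_halfSpace_le f.isLinear d).segment_subset hp hq hz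

/-- The convex hull of four points, one in each closed quadrant of two lines, contains a common
point of the lines. -/
theorem exists_mem_convexHull_of_quadrants (X Z : Plane →ₗ[ℝ] ℝ) {c d : ℝ} {g : Fin 4 → Plane}
    (h₀ : X (g 0) ≤ c ∧ Z (g 0) ≤ d) (h₁ : X (g 1) ≤ c ∧ d ≤ Z (g 1))
    (h₂ : c ≤ X (g 2) ∧ Z (g 2) ≤ d) (h₃ : c ≤ X (g 3) ∧ d ≤ Z (g 3)) :
    ∃ z ∈ convexHull ℝ (Set.range g), X z = c ∧ Z z = d := by
  have hg : ∀ i, g i ∈ convexHull ℝ (Set.range g) := fun i =>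
    subset_convexHull ℝ _ (Set.mem_range_self i)
  have hconv := convex_convexHull ℝ (Set.range g)
  obtain ⟨u, hu, hXu⟩ := exists_mem_segment_apply_eq X h₀.1 h₂.1
  obtain ⟨v, hv, hXv⟩ := exists_mem_segment_apply_eq X h₁.1 h₃.1
  obtain ⟨z, hz, hZz⟩ := exists_mem_segment_apply_eq Z
    (apply_le_of_mem_segment Z h₀.2 h₂.2 hu) (le_apply_of_mem_segment Z h₁.2 h₃.2 hv)
  refine ⟨z, hconv.segment_subset (hconv.segment_subset (hg 0) (hg 2) hu)
    (hconv.segment_subset (hg 1) (hg 3) hv) hz, le_antisymm ?_ ?_, hZz⟩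
  · exact apply_le_of_mem_segment X hXu.le hXv.le hz
  · exact le_apply_of_mem_segment X hXu.ge hXv.ge hz

/-- Some functional `p 0 + s * p 1` separates the points of a finite set. -/
theorem exists_injOn_coordinate (S : Finset Plane) :
    ∃ s : ℝ, Set.InjOn (fun p : Plane => p 0 + s * p 1) S := by
  -- Each pair with different second coordinates excludes at most one value of `s`.
  have hfin : (⋃ x ∈ (S ×ˢ S : Finset (Plane × Plane)),
      {s : ℝ | s * (x.1 1 - x.2 1) = x.2 0 - x.1 0 ∧ x.1 1 ≠ x.2 1}).Finite := by
    refine Set.Finite.biUnion (Finset.finite_toSet _) fun x _ => Set.Subsingleton.finite ?_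
    rintro s ⟨hs, hne⟩ s' ⟨hs', -⟩
    exact mul_right_cancel₀ (sub_ne_zero.2 hne) (hs.trans hs'.symm)
  obtain ⟨s, hs⟩ := hfin.exists_notMem
  refine ⟨s, fun p hp q hq hpq => ?_⟩
  simp only at hpq
  have h1 : p 1 = q 1 := by
    by_contra hne
    refine hs (Set.mem_biUnion (x := (p, q)) (Finset.mem_coe.2 (Finset.mem_product.2 ⟨hp, hq⟩))
      ⟨?_, hne⟩)
    simp only
    linarith
  have h0 : p 0 = q 0 := by
    rw [h1] at hpq
    linarith
  ext i
  fin_cases i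
  · exact h0
  · exact h1

/-- Among `4 k` points there are `k` disjoint quadruples any two of which span segments that
meet. -/
theorem exists_quadruples_segments_meet {S : Finset Plane} {k : ℕ} (hS : 4 * k ≤ S.card) :
    ∃ f : Fin k → Fin 4 → Plane, (∀ a j, f a j ∈ S) ∧
      (∀ a b i j, f a i = f b j → a = b ∧ i = j) ∧
      ∀ a b, a ≠ b → ∃ i i' j j',
        (segment ℝ (f a i) (f a i') ∩ segment ℝ (f b j) (f b j')).Nonempty := by
  classical
  rcases Nat.eq_zero_or_pos k with rfl | hk
  · exact ⟨fun a => a.elim0, fun a => a.elim0, fun a => a.elim0, fun a => a.elim0⟩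
  obtain ⟨T, hTS, hTc⟩ := Finset.exists_subset_card_eq hS
  obtain ⟨s, hs⟩ := exists_injOn_coordinate T
  let Y : Plane →ₗ[ℝ] ℝ := (EuclideanSpace.proj (𝕜 := ℝ) (1 : Fin 2)).toLinearMap
  let X : Plane →ₗ[ℝ] ℝ := (EuclideanSpace.proj (𝕜 := ℝ) (0 : Fin 2)).toLinearMap + s • Y
  have hXT : Set.InjOn X T := hs
  obtain ⟨c, m, d, Q, hQT, hQc, hQd, h₀, h₁, h₂, h₃⟩ :=
    exists_four_partition (Y := Y) hk hTc hXT
  obtain ⟨f, hfQ, hinj, hnest⟩ := exists_transversals_not_nested Q hQc hQd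
  refine ⟨f, fun a j => hTS (hQT j (hfQ a j)), hinj, fun a b hab => ?_⟩
  have hz : ∀ a, ∃ z ∈ convexHull ℝ (Set.range (f a)), X z = c ∧ (Y - m • X) z = d := fun a =>
    exists_mem_convexHull_of_quadrants X (Y - m • X) (h₀ _ (hfQ a 0)) (h₁ _ (hfQ a 1))
      (h₂ _ (hfQ a 2)) (h₃ _ (hfQ a 3))
  obtain ⟨z, hza, hzc, hzd⟩ := hz a
  obtain ⟨w, hwb, hwc, hwd⟩ := hz b
  have hzw : z = w := by
    simp only [LinearMap.sub_apply, LinearMap.smul_apply, hzc, hwc] at hzd hwd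
    have h1 : z 1 = w 1 := by
      change Y z = Y w
      linarith
    have h0 : z 0 = w 0 := by
      have h : z 0 + s * z 1 = w 0 + s * w 1 := hzc.trans hwc.symm
      rw [h1] at h
      linarith
    ext i
    fin_cases i
    · exact h0
    · exact h1
  subst hzw
  obtain ⟨j, hj⟩ := hnest a b hab
  obtain ⟨i, hi⟩ := hnest b a hab.symm
  obtain ⟨_, ⟨i, rfl⟩, _, ⟨i', rfl⟩, _, ⟨j, rfl⟩, _, ⟨j', rfl⟩, h⟩ :=
    exists_segments_meet hza hwb (Set.mem_range_self i) hi (Set.mem_range_self j) hj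
  exact ⟨i, i', j, j', h⟩

/-! ### Padding to t vertices and assembling the family -/

/-- Disjoint indexed `r`-sets inside a large finite set extend to disjoint indexed
`(r + m)`-sets. -/
theorem exists_extend_tuples {α : Type*} {S : Finset α} {k r m : ℕ} (hS : k * (r + m) ≤ S.card)
    {f : Fin k → Fin r → α} (hfS : ∀ a j, f a j ∈ S)
    (hf : ∀ a b i j, f a i = f b j → a = b ∧ i = j) :
    ∃ g : Fin k → Fin r ⊕ Fin m → α, (∀ a j, g a j ∈ S) ∧ (∀ a j, g a (Sum.inl j) = f a j) ∧
      ∀ a b i j, g a i = g b j → a = b ∧ i = j := by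
  classical
  let U : Finset α := Finset.univ.image fun x : Fin k × Fin r => f x.1 x.2
  have hUS : U ⊆ S := by
    intro x hx
    obtain ⟨y, -, rfl⟩ := Finset.mem_image.1 hx
    exact hfS _ _
  have hUc : U.card ≤ k * r := by
    simpa using Finset.card_image_le (s := Finset.univ) (f := fun x : Fin k × Fin r => f x.1 x.2)
  have hc : Fintype.card (Fin k × Fin m) ≤ Fintype.card (S \ U : Finset α) := by
    simp only [Fintype.card_prod, Fintype.card_fin, Fintype.card_coe]
    rw [Finset.card_sdiff_of_subset hUS]
    rw [mul_add] at hS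
    omega
  obtain ⟨e⟩ := Function.Embedding.nonempty_of_card_le hc
  have he : ∀ x, (e x : α) ∈ S ∧ (e x : α) ∉ U := fun x => Finset.mem_sdiff.1 (e x).2
  have hU : ∀ a j, f a j ∈ U := fun a j =>
    Finset.mem_image.2 ⟨(a, j), Finset.mem_univ _, rfl⟩
  refine ⟨fun a => Sum.elim (f a) fun j => (e (a, j) : α), ?_, fun a j => rfl, ?_⟩
  · rintro a (j | j)
    · exact hfS a j
    · exact (he _).1
  · rintro a b (i | i) (j | j) h <;> simp only [Sum.elim_inl, Sum.elim_inr] at h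
    · obtain ⟨rfl, rfl⟩ := hf _ _ _ _ h
      exact ⟨rfl, rfl⟩
    · exact absurd (h ▸ hU a i) (he (b, j)).2
    · exact absurd (h ▸ hU b j) (he (a, i)).2
    · have := e.injective (Subtype.val_injective h)
      simp only [Prod.mk.injEq] at this
      obtain ⟨rfl, rfl⟩ := this
      exact ⟨rfl, rfl⟩

theorem GeometricGraph.IsComplete.iso_induce_range {K : GeometricGraph} (hK : K.IsComplete)
    {ι κ : Type*} (e : κ ≃ ι) {g : ι → K.verts} (hg : Function.Injective g) :
    Nonempty (SimpleGraph.completeGraph κ ≃g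
      ((⊤ : K.graph.Subgraph).induce (Set.range g)).coe) := by
  refine ⟨⟨e.trans (Equiv.ofInjective g hg), fun {i j} => ?_⟩⟩
  rw [SimpleGraph.completeGraph, SimpleGraph.top_adj]
  constructor
  · rintro ⟨-, -, h⟩ rfl
    exact K.graph.loopless.irrefl _ h
  · exact fun h => ⟨Set.mem_range_self _, Set.mem_range_self _,
      hK _ _ fun h' => h (e.injective (hg h'))⟩

theorem mainTheorem6 (t : ℕ) (ht : 4 ≤ t) (n : ℕ) (K : GeometricGraph)
    (hn : K.verts.card = n) (hgp : InGeneralPosition K.verts) (hK : K.IsComplete) :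
    ∃ F : Finset K.graph.Subgraph,
      GeometricGraph.IsCrossingFamily (SimpleGraph.completeGraph (Fin t)) F ∧ F.card = n / t := by
  classical
  obtain ⟨r, rfl⟩ := Nat.exists_eq_add_of_le ht
  have hk : n / (4 + r) * (4 + r) ≤ K.verts.card := hn ▸ Nat.div_mul_le_self n (4 + r)
  obtain ⟨f, hfS, hfinj, hfmeet⟩ := exists_quadruples_segments_meet
    (S := K.verts) (k := n / (4 + r)) (by rw [mul_add] at hk; omega)
  obtain ⟨g, hgS, hgf, hginj⟩ := exists_extend_tuples hk hfS hfinj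
  let v : Fin (n / (4 + r)) → Fin 4 ⊕ Fin r → K.verts := fun a j => ⟨g a j, hgS a j⟩
  have hv : ∀ a b i j, v a i = v b j → a = b ∧ i = j := fun a b i j h =>
    hginj a b i j (congrArg Subtype.val h)
  let A : Fin (n / (4 + r)) → K.graph.Subgraph := fun a => (⊤ : K.graph.Subgraph).induce
    (Set.range (v a))
  have hdisj : ∀ a b, a ≠ b → Disjoint (A a).verts (A b).verts := by
    intro a b hab
    rw [Set.disjoint_left]
    rintro _ ⟨i, rfl⟩ ⟨j, hj⟩
    exact hab (hv _ _ _ _ hj).1.symm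
  have hA : Function.Injective A := by
    intro a b hab
    by_contra hne
    have h : v a (Sum.inl 0) ∈ (A a).verts := Set.mem_range_self _
    exact Set.disjoint_left.1 (hdisj a b hne) h (hab ▸ h)
  refine ⟨Finset.univ.map ⟨A, hA⟩, ⟨?_, ?_, ?_⟩, by simp⟩
  · intro B hB
    obtain ⟨a, -, rfl⟩ := Finset.mem_map.1 hB
    exact hK.iso_induce_range finSumFinEquiv.symm fun i j h => (hv _ _ _ _ h).2
  · intro B hB C hC hBC
    obtain ⟨a, -, rfl⟩ := Finset.mem_map.1 hB
    obtain ⟨b, -, rfl⟩ := Finset.mem_map.1 hC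
    exact hdisj a b fun h => hBC (h ▸ rfl)
  · intro B hB C hC hBC
    obtain ⟨a, -, rfl⟩ := Finset.mem_map.1 hB
    obtain ⟨b, -, rfl⟩ := Finset.mem_map.1 hC
    have hab : a ≠ b := fun h => hBC (h ▸ rfl)
    obtain ⟨i, i', j, j', hmeet⟩ := hfmeet a b hab
    have hne : ∀ i j, f a i ≠ f b j := fun i j h => hab (hfinj _ _ _ _ h).1
    obtain ⟨hi, hj, huniq⟩ := hgp.existsUnique_mem_openSegments (hfS a i) (hfS a i') (hfS b j)
      (hfS b j') (hne i j) (hne i j') (hne i' j) (hne i' j') hmeet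
    have hval : ∀ c l, (v c (Sum.inl l) : Plane) = f c l := hgf
    have hadj : ∀ c l l', f c l ≠ f c l' → (A c).Adj (v c (Sum.inl l)) (v c (Sum.inl l')) := by
      intro c l l' h
      refine ⟨Set.mem_range_self _, Set.mem_range_self _, hK _ _ fun h' => h ?_⟩
      rw [← hval, ← hval, h']
    refine ⟨_, _, _, _, hadj a i i' hi, hadj b j j' hj, ?_⟩
    simpa only [hval] using huniq
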